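/- Let $n\ge 0$ and let $t\mapsto M^t$ and $t\mapsto N^t$ be one-parameter subgroups of $\mathrm{GL}(n,\mathbb R)$ (continuous homomorphisms from $(\mathbb R,+)$), with $M=M^1$, $N=N^1$. Let $G_M=\mathbb R^n\rtimes_M\mathbb R$ be the Lie group $\mathbb R^n\times\mathbb R$ with multiplication $(x,t)\cdot(y,s)=(x+M^ty,\,t+s)$, endowed with the left-invariant Riemannian metric that is Euclidean at the identity; at $(x,t)$ it is $\|M^{-t}\,dx\|^2+dt^2$. Its horizontal foliation is the decomposition into the leaves $\mathbb R^n\times\{t\}$, $t\in\mathbb R$. The doubled $G_N$-horoball $H_N$ is the metric space obtained by identifying two copies of $\{(x,t)\in G_N : t\ge 0\}$ along $\{(x,0)\in G_N\}$, endowed with the path metric. Its horizontal foliation is the decomposition into the fibres of the map $H_N\to\mathbb R$ that is $(x,t)\mapsto t$ on one copy and $(x,t)\mapsto -t$ on the other. A map $f\colon X\to Y$ of metric spaces is a quasi-isometry if there are $K\ge 1$, $C\ge 0$ such that $\frac1K d(x,x')-C\le d(f(x),f(x'))\le K\,d(x,x')+C$ for all $x,x'\in X$ and $d(y,f(X))\le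 C$ for all $y\in Y$. It coarsely respects decompositions $\mathcal F$ of $X$ and $\mathcal G$ of $Y$ if there are $A\ge 0$ and a map $h\colon\mathcal F\to\mathcal G$ such that the Hausdorff distance between $f(L)$ and $h(L)$ is at most $A$ for each $L\in\mathcal F$. **Proposition.** If $\det M>1$ and $\det N>1$, then there is no quasi-isometry $\phi\colon G_M\to H_N$ which coarsely respects the horizontal foliations. -/

import Mathlib

open Set Topology Manifold Bundle Bornology
open scoped ENNReal NNReal

/-- A one-parameter subgroup `t ↦ M^t` of `GL(n, ℝ)`: a continuous homomorphism from the additive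
group `ℝ`. -/
abbrev OneParamSubgroup (n : ℕ) : Type :=
  Multiplicative ℝ →ₜ* GL (Fin n) ℝ

namespace OneParamSubgroup

variable {n : ℕ}

/-- The matrix `M^t`. -/
def mat (M : OneParamSubgroup n) (t : ℝ) : Matrix (Fin n) (Fin n) ℝ :=
  (M (Multiplicative.ofAdd t) : Matrix (Fin n) (Fin n) ℝ)

theorem mat_zero (M : OneParamSubgroup n) : M.mat 0 = 1 := by
  simp [mat]

theorem mat_add (M : OneParamSubgroup n) (s t : ℝ) : M.mat (s + t) = M.mat s * M.mat t := by
  simp [mat, ofAdd_add]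

theorem continuous_mat (M : OneParamSubgroup n) : Continuous M.mat := by
  have h : Continuous fun t : ℝ => M (Multiplicative.ofAdd t) :=
    M.continuous_toFun.comp continuous_ofAdd
  exact Units.continuous_val.comp h

/-- The linear action of `M^t` on Euclidean space `ℝⁿ`. -/
noncomputable def act (M : OneParamSubgroup n) (t : ℝ) :
    EuclideanSpace ℝ (Fin n) →L[ℝ] EuclideanSpace ℝ (Fin n) :=
  Matrix.toEuclideanCLM (n := Fin n) (𝕜 := ℝ) (M.mat t)

theorem act_zero (M : OneParamSubgroup n) (x : EuclideanSpace ℝ (Fin n)) : M.act 0 x = x := by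
  simp [act, mat_zero]

theorem act_add (M : OneParamSubgroup n) (s t : ℝ) (x : EuclideanSpace ℝ (Fin n)) :
    M.act (s + t) x = M.act s (M.act t x) := by
  simp [act, mat_add]

theorem continuous_act (M : OneParamSubgroup n) : Continuous M.act := by
  have h : Continuous fun A : Matrix (Fin n) (Fin n) ℝ =>
      Matrix.toEuclideanCLM (n := Fin n) (𝕜 := ℝ) A :=
    LinearMap.continuous_of_finiteDimensional
      (Matrix.toEuclideanCLM (n := Fin n) (𝕜 := ℝ)).toAlgEquiv.toLinearMap
  exact h.comp M.continuous_mat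

end OneParamSubgroup

/-- On a vector space, a continuous family of bilinear forms is a continuous section of the bundle
of bilinear forms on the tangent spaces. -/
theorem continuous_bilinSection {F : Type*} [NormedAddCommGroup F] [NormedSpace ℝ F]
    {φ : F → (F →L[ℝ] F →L[ℝ] ℝ)} (h : Continuous φ) :
    Continuous fun x : F => TotalSpace.mk' (F →L[ℝ] F →L[ℝ] ℝ)
      (E := fun x : F => TangentSpace 𝓘(ℝ, F) x →L[ℝ] TangentSpace 𝓘(ℝ, F) x →L[ℝ] ℝ)
      x (φ x) := by
  rw [continuous_iff_continuousAt]
  intro g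
  rw [continuousAt_hom_bundle]
  refine ⟨continuousAt_id, ?_⟩
  convert! h.continuousAt (x := g) using 1
  funext y
  have hb : y ∈ (trivializationAt F (TangentSpace 𝓘(ℝ, F)) g).baseSet := mem_univ y
  have hs : ∀ v : F, (trivializationAt F (TangentSpace 𝓘(ℝ, F)) g).symm y v = v := fun v => by
    have h₀ := DFunLike.congr_fun (TangentBundle.symmL_model_space (𝕜 := ℝ) g y) v
    rw [Trivialization.symmL_apply _ hb] at h₀
    exact h₀
  refine ContinuousLinearMap.ext fun v => ContinuousLinearMap.ext fun w => ?_
  rw [inCoordinates_apply_eq₂ hb hb (by simp), hs, hs]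
  simp only [Trivial.fiberBundle_trivializationAt', Trivial.linearMapAt_trivialization]
  rfl

/-- The vector space `ℝⁿ × ℝ`, on which `G_M` is modelled as a manifold. Its product norm plays no
role in the metric of `G_M`, which is given by `SolvGroup.form`. -/
abbrev EModel (n : ℕ) : Type := EuclideanSpace ℝ (Fin n) × ℝ

/-- The underlying set `ℝⁿ × ℝ` of the solvable Lie group `G_M = ℝⁿ ⋊_M ℝ`, as a manifold with a
single chart. -/
def SolvGroup {n : ℕ} (_M : OneParamSubgroup n) : Type := EModel n

namespace SolvGroup

variable {n : ℕ} {M : OneParamSubgroup n}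

instance : TopologicalSpace (SolvGroup M) := inferInstanceAs (TopologicalSpace (EModel n))

instance : ChartedSpace (EModel n) (SolvGroup M) :=
  inferInstanceAs (ChartedSpace (EModel n) (EModel n))

instance : IsManifold 𝓘(ℝ, EModel n) 1 (SolvGroup M) :=
  inferInstanceAs (IsManifold 𝓘(ℝ, EModel n) 1 (EModel n))

instance : T3Space (SolvGroup M) := inferInstanceAs (T3Space (EModel n))

/-- The point `(x, t)`. -/
def mk (M : OneParamSubgroup n) (x : EuclideanSpace ℝ (Fin n)) (t : ℝ) : SolvGroup M :=
  ((x, t) : EModel n)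

/-- The `ℝⁿ`-coordinate `x` of `(x, t)`. -/
def pos (g : SolvGroup M) : EuclideanSpace ℝ (Fin n) := (id g : EModel n).1

/-- The time function `(x, t) ↦ t`. -/
def height (g : SolvGroup M) : ℝ := (id g : EModel n).2

@[ext] theorem ext {g h : SolvGroup M} (h₁ : g.pos = h.pos) (h₂ : g.height = h.height) : g = h :=
  Prod.ext h₁ h₂

@[simp] theorem pos_mk (x : EuclideanSpace ℝ (Fin n)) (t : ℝ) : (mk M x t).pos = x := rfl
@[simp] theorem height_mk (x : EuclideanSpace ℝ (Fin n)) (t : ℝ) : (mk M x t).height = t := rfl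

theorem continuous_height : Continuous (height : SolvGroup M → ℝ) :=
  continuous_snd (X := EuclideanSpace ℝ (Fin n)) (Y := ℝ)

/-- The semidirect product law `(x, t) (y, s) = (x + M^t y, t + s)`. -/
noncomputable instance : Group (SolvGroup M) where
  mul g h := mk M (g.pos + M.act g.height h.pos) (g.height + h.height)
  one := mk M 0 0
  inv g := mk M (- M.act (-g.height) g.pos) (-g.height)
  mul_assoc a b c := by
    apply ext
    · change (a.pos + M.act a.height b.pos) + M.act (a.height + b.height) c.pos =
        a.pos + M.act a.height (b.pos + M.act b.height c.pos)
      rw [M.act_add, map_add, add_assoc]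
    · exact add_assoc _ _ _
  one_mul a := by
    apply ext
    · change 0 + M.act 0 a.pos = a.pos
      rw [M.act_zero, zero_add]
    · exact zero_add a.height
  mul_one a := by
    apply ext
    · change a.pos + M.act a.height 0 = a.pos
      rw [map_zero, add_zero]
    · exact add_zero a.height
  inv_mul_cancel a := by
    apply ext
    · exact neg_add_cancel (M.act (-a.height) a.pos)
    · exact neg_add_cancel a.height

/-- The linear map `(v, τ) ↦ (M^{-t} v, τ)`, which is the derivative of left translation by
`(x, t)⁻¹`, see `hasMFDerivAt_leftTranslation`. -/
noncomputable def dLeft (M : OneParamSubgroup n) (t : ℝ) : EModel n →L[ℝ] EModel n :=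
  (M.act (-t)).prodMap (ContinuousLinearMap.id ℝ ℝ)

theorem dLeft_apply (t : ℝ) (v : EModel n) : dLeft M t v = (M.act (-t) v.1, v.2) := rfl

theorem dLeft_leftInverse (t : ℝ) (v : EModel n) : dLeft M (-t) (dLeft M t v) = v := by
  simp [dLeft_apply, ← M.act_add, M.act_zero]

theorem continuous_dLeft : Continuous (dLeft M) :=
  (ContinuousLinearMap.prodMapL ℝ _ _ _ _).continuous.comp
    ((M.continuous_act.comp continuous_neg).prodMk continuous_const)

theorem hasMFDerivAt_leftTranslation (g h : SolvGroup M) :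
    HasMFDerivAt 𝓘(ℝ, EModel n) 𝓘(ℝ, EModel n) (fun k : SolvGroup M => g⁻¹ * k) h
      (dLeft M g.height) :=
  HasFDerivAt.hasMFDerivAt (𝕜 := ℝ) (E := EModel n) (E' := EModel n)
    (f := fun k : EModel n => (id (g⁻¹ : SolvGroup M) : EModel n) + dLeft M g.height k)
    ((dLeft M g.height).hasFDerivAt.const_add _)

/-- The Euclidean inner product `⟪v, w⟫ + τ σ` of `(v, τ)` and `(w, σ)` on `ℝⁿ × ℝ = ℝⁿ⁺¹`. -/
noncomputable def euclideanForm (n : ℕ) : EModel n →L[ℝ] EModel n →L[ℝ] ℝ :=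
  (innerSL ℝ (E := EuclideanSpace ℝ (Fin n))).bilinearComp
      (ContinuousLinearMap.fst ℝ _ ℝ) (ContinuousLinearMap.fst ℝ _ ℝ) +
    (ContinuousLinearMap.mul ℝ ℝ).bilinearComp
      (ContinuousLinearMap.snd ℝ _ ℝ) (ContinuousLinearMap.snd ℝ _ ℝ)

/-- The pullback of the Euclidean inner product by `dLeft M t`. -/
noncomputable def form (M : OneParamSubgroup n) (t : ℝ) : EModel n →L[ℝ] EModel n →L[ℝ] ℝ :=
  (euclideanForm n).bilinearComp (dLeft M t) (dLeft M t)

theorem form_apply (t : ℝ) (v w : EModel n) :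
    form M t v w = inner ℝ (M.act (-t) v.1) (M.act (-t) w.1) + v.2 * w.2 := rfl

theorem form_self (t : ℝ) (v : EModel n) :
    form M t v v = ‖M.act (-t) v.1‖ ^ 2 + v.2 ^ 2 := by
  rw [form_apply, real_inner_self_eq_norm_sq, sq v.2]

theorem form_symm (t : ℝ) (v w : EModel n) : form M t v w = form M t w v := by
  rw [form_apply, form_apply, real_inner_comm, mul_comm]

theorem norm_dLeft_sq_le (t : ℝ) (v : EModel n) : ‖dLeft M t v‖ ^ 2 ≤ form M t v v := by
  rw [form_self, dLeft_apply, Prod.norm_def]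
  rcases max_choice ‖M.act (-t) v.1‖ ‖v.2‖ with h | h
  · simp only [h]
    nlinarith [sq_nonneg v.2]
  · simp only [h]
    rw [Real.norm_eq_abs, sq_abs]
    nlinarith [sq_nonneg ‖M.act (-t) v.1‖]

theorem form_pos (t : ℝ) {v : EModel n} (hv : v ≠ 0) : 0 < form M t v v := by
  have h : dLeft M t v ≠ 0 := fun h => hv (by
    rw [← dLeft_leftInverse (M := M) t v, h, map_zero])
  exact (pow_pos (norm_pos_iff.2 h) 2).trans_le (norm_dLeft_sq_le t v)

theorem isVonNBounded_form (t : ℝ) : IsVonNBounded ℝ {v : EModel n | form M t v v < 1} := by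
  refine ((NormedSpace.isVonNBounded_ball ℝ (EModel n) 1).image (dLeft M (-t))).subset ?_
  intro v hv
  refine ⟨dLeft M t v, ?_, dLeft_leftInverse _ _⟩
  have hv' : form M t v v < 1 := hv
  rw [mem_ball_zero_iff]
  nlinarith [norm_nonneg (dLeft M t v), norm_dLeft_sq_le (M := M) t v]

theorem continuous_form : Continuous (form M) := by
  have h₁ : Continuous fun t : ℝ => (euclideanForm n) ∘L (dLeft M t) :=
    continuous_const.clm_comp continuous_dLeft
  have h₂ := ((ContinuousLinearMap.flipₗᵢ ℝ (EModel n) (EModel n) ℝ).continuous.comp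
    h₁).clm_comp (continuous_dLeft (M := M))
  exact (ContinuousLinearMap.flipₗᵢ ℝ (EModel n) (EModel n) ℝ).continuous.comp h₂

/-- The left invariant Riemannian metric on `G_M` which is Euclidean at the identity: the inner
product at `g` is the pullback of the Euclidean one under the derivative at `g` of left translation
by `g⁻¹`. In matrix form it is `(M^{-t})ᵀ M^{-t}` on `ℝⁿ`, plus `dt²`; see `form_self`. -/
noncomputable def metric (M : OneParamSubgroup n) :
    ContinuousRiemannianMetric (EModel n)
      (fun g : SolvGroup M => TangentSpace 𝓘(ℝ, EModel n) g) where
  inner g := form M g.height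
  symm g v w := form_symm g.height v w
  pos g _ hv := form_pos g.height hv
  isVonNBounded g := isVonNBounded_form g.height
  continuous := continuous_bilinSection (F := EModel n)
    (φ := fun g : SolvGroup M => form M g.height) (continuous_form.comp continuous_height)

noncomputable instance :
    RiemannianBundle (fun g : SolvGroup M => TangentSpace 𝓘(ℝ, EModel n) g) :=
  ⟨(metric M).toRiemannianMetric⟩

/-- The Riemannian distance of `G_M`. -/
noncomputable instance : EMetricSpace (SolvGroup M) :=
  EMetricSpace.ofRiemannianMetric 𝓘(ℝ, EModel n) (SolvGroup M)

/-- The horizontal foliation of `G_M`: its leaves are the level sets of the time function. -/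
def horizontalFoliation (M : OneParamSubgroup n) : Set (Set (SolvGroup M)) :=
  range fun t : ℝ => {g : SolvGroup M | g.height = t}

end SolvGroup

/-- The subspace `{(x, t) ∈ G_M : t ≥ 0}`. -/
abbrev Horoball {n : ℕ} (M : OneParamSubgroup n) : Type := {g : SolvGroup M // 0 ≤ g.height}

/-- Two copies of the horoball, identified along `t = 0`. -/
def gluingSetoid {n : ℕ} (M : OneParamSubgroup n) : Setoid (Bool × Horoball M) where
  r p q := p = q ∨ (p.2 = q.2 ∧ p.2.1.height = 0)
  iseqv :=
    { refl := fun _ => Or.inl rfl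
      symm := by
        rintro p q (rfl | ⟨h, h0⟩)
        · exact Or.inl rfl
        · exact Or.inr ⟨h.symm, h ▸ h0⟩
      trans := by
        rintro p q r (rfl | ⟨h, h0⟩) (rfl | ⟨h', h0'⟩)
        · exact Or.inl rfl
        · exact Or.inr ⟨h', h0'⟩
        · exact Or.inr ⟨h, h0⟩
        · exact Or.inr ⟨h.trans h', h0⟩ }

/-- The topological space obtained by gluing the two copies, with the quotient topology. -/
def GluedHoroballs {n : ℕ} (M : OneParamSubgroup n) : Type := Quotient (gluingSetoid M)

namespace GluedHoroballs

variable {n : ℕ} {M : OneParamSubgroup n}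

instance : TopologicalSpace (GluedHoroballs M) :=
  inferInstanceAs (TopologicalSpace (Quotient (gluingSetoid M)))

/-- The point `g` of the copy with index `b`. -/
def mk (b : Bool) (g : Horoball M) : GluedHoroballs M := Quotient.mk (gluingSetoid M) (b, g)

/-- The folding map to `G_M`, which is the inclusion on each of the two copies. -/
def fold (p : GluedHoroballs M) : SolvGroup M :=
  Quotient.lift (fun q : Bool × Horoball M => q.2.1)
    (by
      rintro p q (rfl | ⟨h, -⟩)
      · rfl
      · exact congrArg Subtype.val h) p

/-- The signed height: the time function on one copy and its negative on the other. -/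
def height (p : GluedHoroballs M) : ℝ :=
  Quotient.lift (fun q : Bool × Horoball M => if q.1 then q.2.1.height else -q.2.1.height)
    (by
      rintro ⟨a, p⟩ ⟨b, q⟩ (h | ⟨h, h0⟩)
      · rw [h]
      · simp only at h h0
        subst h
        simp [h0]) p

/-- The length of a curve in the glued space. On each copy the folding map is the inclusion
into `G_M`, so this is the length (total variation with respect to the metric of `G_M`) of the
parts of the curve in the two copies. -/
noncomputable def length {p q : GluedHoroballs M} (γ : Path p q) : ℝ≥0∞ :=
  eVariationOn (fun s => fold (γ s)) univ

theorem length_refl (p : GluedHoroballs M) : length (Path.refl p) = 0 :=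
  eVariationOn.constant_on (by
    rintro _ ⟨_, -, rfl⟩ _ ⟨_, -, rfl⟩
    rfl)

theorem length_symm {p q : GluedHoroballs M} (γ : Path p q) : length γ.symm = length γ := by
  refine le_antisymm ?_ ?_
  · exact eVariationOn.comp_le_of_antitoneOn (fun s => fold (γ s)) unitInterval.symm
      (fun a _ b _ h => unitInterval.symm_le_symm.2 h) (mapsTo_univ _ _)
  · have := eVariationOn.comp_le_of_antitoneOn (fun s => fold (γ.symm s)) unitInterval.symm
      (s := univ) (t := univ)
      (fun a _ b _ h => unitInterval.symm_le_symm.2 h) (mapsTo_univ _ _)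
    simpa [length, Function.comp_def, Path.symm_apply] using this

theorem length_trans_le {p q r : GluedHoroballs M} (γ : Path p q) (δ : Path q r) :
    length (γ.trans δ) ≤ length γ + length δ := by
  let c : unitInterval := ⟨1 / 2, by norm_num, by norm_num⟩
  have hc : eVariationOn (fun s => fold (γ.trans δ s)) univ =
      eVariationOn (fun s => fold (γ.trans δ s)) (Iic c) +
        eVariationOn (fun s => fold (γ.trans δ s)) (Ici c) := by
    rw [← Iic_union_Ici (a := c)]
    exact eVariationOn.union _ isGreatest_Iic isLeast_Ici
  unfold length
  rw [hc]
  refine add_le_add ?_ ?_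
  · have h : EqOn (fun s => fold (γ.trans δ s))
        ((fun s => fold (γ s)) ∘ fun s : unitInterval => projIcc (0 : ℝ) 1 zero_le_one (2 * s))
        (Iic c) := by
      intro s hs
      have hs' : (s : ℝ) ≤ 1 / 2 := hs
      change fold (if (s : ℝ) ≤ 1 / 2 then γ.extend (2 * s) else δ.extend (2 * s - 1)) = _
      rw [if_pos hs']
      rfl
    rw [eVariationOn.congr h]
    exact eVariationOn.comp_le_of_monotoneOn _ _
      (fun a _ b _ hab => monotone_projIcc _ (by
        have : (a : ℝ) ≤ b := hab
        linarith)) (mapsTo_univ _ _)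
  · have h : EqOn (fun s => fold (γ.trans δ s))
        ((fun s => fold (δ s)) ∘
          fun s : unitInterval => projIcc (0 : ℝ) 1 zero_le_one (2 * s - 1)) (Ici c) := by
      intro s hs
      have hs' : 1 / 2 ≤ (s : ℝ) := hs
      change fold (if (s : ℝ) ≤ 1 / 2 then γ.extend (2 * s) else δ.extend (2 * s - 1)) =
        fold (δ.extend (2 * s - 1))
      split_ifs with h'
      · have hs'' : (s : ℝ) = 1 / 2 := le_antisymm h' hs'
        rw [hs'']
        norm_num
      · rfl
    rw [eVariationOn.congr h]
    exact eVariationOn.comp_le_of_monotoneOn _ _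
      (fun a _ b _ hab => monotone_projIcc _ (by
        have : (a : ℝ) ≤ b := hab
        linarith)) (mapsTo_univ _ _)

end GluedHoroballs

/-- The doubled horoball `H_M`: the glued space with its path metric. -/
def DoubledHoroball {n : ℕ} (M : OneParamSubgroup n) : Type := GluedHoroballs M

namespace DoubledHoroball

variable {n : ℕ} {M : OneParamSubgroup n}

/-- A point of `H_M`, seen in the underlying topological space. -/
def toGlued (p : DoubledHoroball M) : GluedHoroballs M := p

/-- The path metric: the distance is the infimum of the lengths of the curves between the two
points. -/
noncomputable instance : PseudoEMetricSpace (DoubledHoroball M) where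
  edist p q := ⨅ γ : Path p.toGlued q.toGlued, GluedHoroballs.length γ
  edist_self p := by
    refine le_antisymm ?_ bot_le
    exact (iInf_le _ (Path.refl p.toGlued)).trans
      (GluedHoroballs.length_refl p.toGlued).le
  edist_comm p q := by
    refine le_antisymm (le_iInf fun γ => ?_) (le_iInf fun γ => ?_) <;>
    exact (iInf_le _ γ.symm).trans (GluedHoroballs.length_symm γ).le
  edist_triangle p q r := by
    refine ENNReal.le_iInf_add_iInf fun γ δ => ?_
    exact (iInf_le _ (γ.trans δ)).trans (GluedHoroballs.length_trans_le γ δ)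

/-- The horizontal foliation of `H_M`: its leaves are the fibres of the signed height function
`H_M → ℝ`. -/
def horizontalFoliation (M : OneParamSubgroup n) : Set (Set (DoubledHoroball M)) :=
  range fun t : ℝ => {p : DoubledHoroball M | p.toGlued.height = t}

end DoubledHoroball

/-- A `(K, C)` quasi-isometry. -/
def IsQuasiIsometryWith {X Y : Type*} [PseudoEMetricSpace X] [PseudoEMetricSpace Y]
    (K C : ℝ≥0) (f : X → Y) : Prop :=
  (∀ x x' : X, edist x x' / K - C ≤ edist (f x) (f x') ∧
    edist (f x) (f x') ≤ K * edist x x' + C) ∧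
  ∀ y : Y, Metric.infEDist y (range f) ≤ C

/-- A quasi-isometry: a `(K, C)` quasi-isometry for some `K ≥ 1` and `C ≥ 0`. -/
def IsQuasiIsometry {X Y : Type*} [PseudoEMetricSpace X] [PseudoEMetricSpace Y]
    (f : X → Y) : Prop :=
  ∃ K C : ℝ≥0, 1 ≤ K ∧ IsQuasiIsometryWith K C f

/-- The map `f` coarsely respects the decompositions `F` of `X` and `G` of `Y`: there are a map
`h` of leaf spaces and a number `A ≥ 0` such that `f(L)` and `h(L)` have Hausdorff distance at most
`A` for every leaf `L`. -/
def CoarselyRespects {X Y : Type*} [PseudoEMetricSpace Y]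
    (f : X → Y) (F : Set (Set X)) (G : Set (Set Y)) : Prop :=
  ∃ (A : ℝ≥0) (h : F → G), ∀ L : F,
    Metric.hausdorffEDist (f '' (L : Set X)) (h L : Set Y) ≤ A

/-!
The space `G_M` is not amenable and the doubled horoball `H_N` is, and amenability is invariant
under quasi-isometries. So there is no quasi-isometry at all between them, whether or not it
respects the foliations.

On `G_M` the measure `det M^{-t} dx dt` is left invariant (`SolvGroup.map_mul_left_vol`), while the
downward flow by time `s`, which moves points by at most `s`, multiplies volumes by `(det M)^s`
(`SolvGroup.vol_preimage_mul_vertical`). Hence the `s`-neighbourhood of any set has at least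
`(det M)^s` times its volume. In `H_N` the heights `t ≥ 0` of each copy of the horoball have finite
total weight `∫ det N^{-t} dt`. So any fixed neighbourhood of the slab
`{(x, t) : ‖x‖ ≤ L, 0 ≤ t ≤ 1}` has volume at most a constant times that of the slab, where the
constant does not depend on the size of the neighbourhood once `L` is large
(`SolvGroup.exists_vol_nhd_slab_le`).

Volumes are transported along a quasi-isometry, which need not be measurable, by counting: sets of
bounded diameter have bounded volume (`SolvGroup.exists_vol_le`), and a set `A` is covered by as
many balls of fixed radius as there are disjoint translates of a box based at points of `A`
(`SolvGroup.exists_packing`). The box consists of elements of nonnegative height, so that its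
translates by points of a horoball stay in the horoball, where the path metric of `H_N` is
controlled by explicit segments (`DoubledHoroball.edist_mk_mul_box_le`). On the other hand the path
metric of `H_N` is bounded below through the folding map to `G_N`
(`DoubledHoroball.edist_fold_le`).
-/

/-! ### Riemannian distances in the solvable group -/

namespace SolvGroup

variable {n : ℕ} {M : OneParamSubgroup n}

theorem enorm_tangent (g : SolvGroup M) (v : TangentSpace 𝓘(ℝ, EModel n) g) :
    ‖v‖ₑ = ENNReal.ofReal (√(form M g.height v v)) := by
  rw [← ofReal_norm, norm_eq_sqrt_real_inner]
  rfl

theorem edist_eq_riemannianEDist (g h : SolvGroup M) :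
    edist g h = riemannianEDist 𝓘(ℝ, EModel n) g h := rfl

/-- The point of `G_M` with given coordinates. -/
def ofModel (M : OneParamSubgroup n) (v : EModel n) : SolvGroup M := mk M v.1 v.2

theorem pathELength_eq (γ : ℝ → EModel n) (a b : ℝ) :
    pathELength 𝓘(ℝ, EModel n) (fun s => ofModel M (γ s)) a b =
      ∫⁻ s in Ioo a b, ENNReal.ofReal (√(form M (γ s).2 (deriv γ s) (deriv γ s))) := by
  rw [pathELength_eq_lintegral_mfderiv_Ioo]
  refine MeasureTheory.lintegral_congr fun s => ?_
  rw [enorm_tangent]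
  have h : mfderiv 𝓘(ℝ, ℝ) 𝓘(ℝ, EModel n) γ s = fderiv ℝ γ s := mfderiv_eq_fderiv
  have h' : (mfderiv 𝓘(ℝ, ℝ) 𝓘(ℝ, EModel n) γ s) (1 : ℝ) = deriv γ s := by
    rw [← fderiv_apply_one_eq_deriv, ← h]
    rfl
  exact congrArg (fun v => ENNReal.ofReal (√(form M (γ s).2 v v))) h'

/-- The straight segment from `p` to `p + v` has length at most the largest norm of `v` along
it. -/
theorem edist_segment_le (p v : EModel n) {c : ℝ}
    (hc : ∀ s ∈ Icc (0 : ℝ) 1, √(form M (p.2 + s * v.2) v v) ≤ c) :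
    edist (mk M p.1 p.2) (mk M (p.1 + v.1) (p.2 + v.2)) ≤ ENNReal.ofReal c := by
  let γ : ℝ → EModel n := fun s => p + s • v
  have hγ : ContDiff ℝ 1 γ := by fun_prop
  have h : riemannianEDist 𝓘(ℝ, EModel n) (mk M p.1 p.2) (mk M (p.1 + v.1) (p.2 + v.2)) ≤
      pathELength 𝓘(ℝ, EModel n) (fun s => ofModel M (γ s)) 0 1 := by
    refine riemannianEDist_le_pathELength (γ := fun s => ofModel M (γ s)) ?_ ?_ ?_ zero_le_one
    · exact (contMDiffOn_iff_contDiffOn (E' := EModel n) (f := γ)).2 hγ.contDiffOn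
    · change p + (0 : ℝ) • v = p
      simp
    · change p + (1 : ℝ) • v = p + v
      simp
  have hd : ∀ s, deriv γ s = v := fun s => by
    have : HasDerivAt γ ((1 : ℝ) • v) s := ((hasDerivAt_id s).smul_const v).const_add p
    simpa using this.deriv
  refine h.trans ?_
  rw [pathELength_eq]
  calc _ ≤ ∫⁻ s in Ioo (0 : ℝ) 1, ENNReal.ofReal c := by
        refine MeasureTheory.setLIntegral_mono measurable_const fun s hs => ?_
        rw [hd]
        exact ENNReal.ofReal_le_ofReal (hc s ⟨hs.1.le, hs.2.le⟩)
    _ = _ := by simp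

theorem edist_horizontal_le (x w : EuclideanSpace ℝ (Fin n)) (t : ℝ) :
    edist (mk M x t) (mk M (x + w) t) ≤ ENNReal.ofReal ‖M.act (-t) w‖ := by
  have h := edist_segment_le (M := M) (x, t) (w, 0) (c := ‖M.act (-t) w‖) fun s _ => by
    rw [form_self]
    simp
  simpa using h

theorem edist_vertical_le (x : EuclideanSpace ℝ (Fin n)) (t τ : ℝ) :
    edist (mk M x t) (mk M x (t + τ)) ≤ ENNReal.ofReal |τ| := by
  have h := edist_segment_le (M := M) (x, t) (0, τ) (c := |τ|) fun s _ => by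
    rw [form_self]
    simp [Real.sqrt_sq_eq_abs]
  simpa using h

/-- If `‖f v‖` is at most `K` times the Riemannian norm of `v` at the points of the curve, then the
variation of the linear function `f` along the curve is at most `K` times its length. -/
theorem enorm_sub_le_mul_pathELength {F : Type*} [NormedAddCommGroup F] [NormedSpace ℝ F]
    [CompleteSpace F] (f : EModel n →L[ℝ] F) {γ : ℝ → EModel n} {b : ℝ} (hb : 0 ≤ b)
    (hγ : ContDiffOn ℝ 1 γ (Icc 0 b)) {K : ℝ} (hK : 0 ≤ K)
    (hf : ∀ s ∈ Ioo 0 b, ∀ v, ‖f v‖ ≤ K * √(form M (γ s).2 v v)) :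
    ‖f (γ b) - f (γ 0)‖ₑ ≤
      ENNReal.ofReal K * pathELength 𝓘(ℝ, EModel n) (fun s => ofModel M (γ s)) 0 b := by
  refine (enorm_sub_le_lintegral_deriv_of_contDiffOn_Icc (f := fun s => f (γ s))
    (f.contDiff.comp_contDiffOn hγ) hb).trans ?_
  rw [pathELength_eq, ← MeasureTheory.lintegral_const_mul' _ _ ENNReal.ofReal_ne_top,
    ← MeasureTheory.restrict_Ioo_eq_restrict_Icc]
  refine MeasureTheory.lintegral_mono_ae ?_
  filter_upwards [MeasureTheory.ae_restrict_mem measurableSet_Ioo] with s hs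
  have hd : DifferentiableAt ℝ γ s :=
    (hγ.differentiableOn (by simp)).differentiableAt (Icc_mem_nhds hs.1 hs.2)
  have : deriv (fun s => f (γ s)) s = f (deriv γ s) :=
    (f.hasFDerivAt.comp_hasDerivAt s hd.hasDerivAt).deriv
  rw [this, ← ENNReal.ofReal_mul hK, ← ofReal_norm]
  exact ENNReal.ofReal_le_ofReal (hf s hs _)

/-- Balls are bounded in left-invariant coordinates: the height changes by at most `r`, and along
a short curve `M^{-t}` is comparable to its value at the starting point. -/
theorem exists_coord_bound (M : OneParamSubgroup n) (r : ℝ≥0) :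
    ∃ b : ℝ, 0 ≤ b ∧ ∀ p q : SolvGroup M, edist p q < r →
      |q.height - p.height| ≤ r ∧ ‖M.act (-p.height) (q.pos - p.pos)‖ ≤ b := by
  obtain ⟨K, hK⟩ : ∃ K, ∀ τ ∈ Icc (-(r : ℝ)) r, ‖M.act τ‖ ≤ K :=
    isCompact_Icc.exists_bound_of_continuousOn M.continuous_act.continuousOn
  have hK0 : 0 ≤ K := (norm_nonneg _).trans (hK 0 ⟨by simp, by simp⟩)
  refine ⟨K * r, by positivity, fun p q hpq => ?_⟩
  rw [edist_eq_riemannianEDist] at hpq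
  obtain ⟨γ, h0, h1, hγ, hl⟩ := exists_lt_of_riemannianEDist_lt hpq
  let η : ℝ → EModel n := γ
  have hη : ContDiffOn ℝ 1 η (Icc 0 1) := (contMDiffOn_iff_contDiffOn (E' := EModel n)).1 hγ
  have hheight : ∀ s ∈ Icc (0 : ℝ) 1, |(η s).2 - p.height| ≤ r := by
    intro s hs
    have h := enorm_sub_le_mul_pathELength (M := M) (ContinuousLinearMap.snd ℝ _ ℝ) hs.1
      (hη.mono (Icc_subset_Icc_right hs.2)) zero_le_one (by
        intro s _ v
        rw [one_mul, form_self, ContinuousLinearMap.coe_snd', Real.norm_eq_abs]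
        exact Real.abs_le_sqrt (by nlinarith [sq_nonneg ‖M.act (-(η s).2) v.1‖]))
    have h2 : pathELength 𝓘(ℝ, EModel n) (fun s => ofModel M (η s)) 0 s ≤ r :=
      (pathELength_mono le_rfl hs.2).trans hl.le
    have h3 : ‖(η s).2 - p.height‖ₑ ≤ r := by
      have e : p.height = (η 0).2 := by rw [← h0]; rfl
      rw [e]
      refine h.trans ?_
      simpa using h2
    have := ENNReal.toReal_mono (by simp) h3
    simpa using this
  have hq : q.height = (η 1).2 := by rw [← h1]; rfl
  refine ⟨hq ▸ hheight 1 (by simp), ?_⟩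
  have h := enorm_sub_le_mul_pathELength (M := M)
    ((M.act (-p.height)).comp (ContinuousLinearMap.fst ℝ _ ℝ)) zero_le_one hη hK0 (by
      intro s hs v
      -- `M^{-t₀} = M^{t - t₀} M^{-t}`, where `t - t₀` lies in the compact interval `[-r, r]`.
      have e : M.act (-p.height) v.1 =
          M.act ((η s).2 - p.height) (M.act (-(η s).2) v.1) := by
        rw [← M.act_add]
        congr 2
        ring
      have hs' := abs_le.1 (hheight s ⟨hs.1.le, hs.2.le⟩)
      change ‖M.act (-p.height) v.1‖ ≤ _
      rw [e]
      refine ((M.act _).le_opNorm _).trans ?_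
      refine mul_le_mul (hK _ hs') ?_ (norm_nonneg _) hK0
      rw [form_self]
      exact Real.le_sqrt_of_sq_le (by nlinarith [sq_nonneg v.2]))
  have e : M.act (-p.height) (q.pos - p.pos) =
      M.act (-p.height) (η 1).1 - M.act (-p.height) (η 0).1 := by
    rw [map_sub, ← h0, ← h1]; rfl
  rw [e]
  have h3 := h.trans (mul_le_mul_right hl.le _)
  have := ENNReal.toReal_mono (by finiteness) h3
  simpa [hK0] using this

end SolvGroup

/-! ### The determinant of a one-parameter subgroup -/

namespace OneParamSubgroup

variable {n : ℕ}

theorem det_mat_pos (M : OneParamSubgroup n) (t : ℝ) : 0 < (M.mat t).det := by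
  have h : M.mat t = M.mat (t / 2) * M.mat (t / 2) := by rw [← M.mat_add, add_halves]
  have h0 : (M.mat (t / 2)).det ≠ 0 := fun h0 => by
    have h1 : M.mat (t / 2) * M.mat (-(t / 2)) = 1 := by
      rw [← M.mat_add, add_neg_cancel, M.mat_zero]
    have h2 := congrArg Matrix.det h1
    simp [h0] at h2
  rw [h, Matrix.det_mul]
  exact mul_self_pos.2 h0

/-- The growth rate `log det M`, so that `det M^t = exp (t log det M)`. -/
noncomputable def rate (M : OneParamSubgroup n) : ℝ := Real.log (M.mat 1).det

theorem det_mat (M : OneParamSubgroup n) (t : ℝ) : (M.mat t).det = Real.exp (t * M.rate) := by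
  let f : ℝ →+ ℝ :=
    { toFun := fun t => Real.log (M.mat t).det
      map_zero' := by simp [M.mat_zero]
      map_add' := fun s t => by
        rw [M.mat_add, Matrix.det_mul, Real.log_mul (M.det_mat_pos s).ne' (M.det_mat_pos t).ne'] }
  have hf : Continuous f :=
    (M.continuous_mat.matrix_det).log fun t => (M.det_mat_pos t).ne'
  have h := map_real_smul f hf t 1
  rw [smul_eq_mul, mul_one, smul_eq_mul] at h
  rw [← Real.exp_log (M.det_mat_pos t)]
  exact congrArg Real.exp h

theorem det_act (M : OneParamSubgroup n) (t : ℝ) :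
    LinearMap.det (M.act t : EuclideanSpace ℝ (Fin n) →ₗ[ℝ] EuclideanSpace ℝ (Fin n)) =
      Real.exp (t * M.rate) := by
  rw [← det_mat]
  have h : (M.act t : EuclideanSpace ℝ (Fin n) →ₗ[ℝ] EuclideanSpace ℝ (Fin n)) =
      Matrix.toLin (EuclideanSpace.basisFun (Fin n) ℝ).toBasis
        (EuclideanSpace.basisFun (Fin n) ℝ).toBasis (M.mat t) :=
    DFunLike.congr_fun (Matrix.toEuclideanLin_eq_toLin_orthonormal (𝕜 := ℝ) (m := Fin n)
      (n := Fin n)) (M.mat t)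
  rw [h, LinearMap.det_toLin]

end OneParamSubgroup

/-! ### The left Haar measure -/

namespace SolvGroup

open MeasureTheory Pointwise

variable {n : ℕ} {M : OneParamSubgroup n}

theorem mul_pos_eq (g h : SolvGroup M) : (g * h).pos = g.pos + M.act g.height h.pos := rfl

instance : MeasurableSpace (SolvGroup M) := inferInstanceAs (MeasurableSpace (EModel n))

theorem measurable_pos : Measurable (pos : SolvGroup M → EuclideanSpace ℝ (Fin n)) :=
  measurable_fst (α := EuclideanSpace ℝ (Fin n)) (β := ℝ)

theorem measurable_height : Measurable (height : SolvGroup M → ℝ) :=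
  measurable_snd (α := EuclideanSpace ℝ (Fin n)) (β := ℝ)

/-- The measure `det M^{-t} dt` on the line of heights. -/
noncomputable def heightMeasure (M : OneParamSubgroup n) : Measure ℝ :=
  volume.withDensity fun t => ENNReal.ofReal (Real.exp (-(t * M.rate)))

instance : SFinite (heightMeasure M) := by
  unfold heightMeasure
  infer_instance

/-- The Riemannian volume `det M^{-t} dx dt`, a left Haar measure. -/
noncomputable def vol (M : OneParamSubgroup n) : Measure (SolvGroup M) :=
  (volume : Measure (EuclideanSpace ℝ (Fin n))).prod (heightMeasure M)

theorem map_add_heightMeasure (s : ℝ) :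
    (heightMeasure M).map (s + ·) = ENNReal.ofReal (Real.exp (s * M.rate)) • heightMeasure M := by
  ext B hB
  have hm : Measurable fun t : ℝ => ENNReal.ofReal (Real.exp (-(t * M.rate))) := by fun_prop
  rw [Measure.map_apply (measurable_const_add s) hB, Measure.smul_apply, smul_eq_mul,
    heightMeasure, withDensity_apply _ hB, withDensity_apply _ (measurable_const_add s hB),
    ← lintegral_const_mul _ hm, ← lintegral_indicator hB,
    ← lintegral_indicator (measurable_const_add s hB)]
  conv_rhs => rw [← lintegral_add_left_eq_self _ s]
  refine lintegral_congr fun t => ?_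
  by_cases h : s + t ∈ B
  · rw [indicator_of_mem h, indicator_of_mem (show t ∈ (s + ·) ⁻¹' B from h),
      ← ENNReal.ofReal_mul (Real.exp_pos _).le, ← Real.exp_add]
    ring_nf
  · rw [indicator_of_notMem h, indicator_of_notMem (show t ∉ (s + ·) ⁻¹' B from h)]

theorem map_affine_volume (a : EuclideanSpace ℝ (Fin n)) (t : ℝ) :
    (volume : Measure (EuclideanSpace ℝ (Fin n))).map (fun x => a + M.act t x) =
      ENNReal.ofReal (Real.exp (-(t * M.rate))) • volume := by
  have h := Measure.map_linearMap_addHaar_eq_smul_addHaar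
    (volume : Measure (EuclideanSpace ℝ (Fin n)))
    (f := (M.act t : EuclideanSpace ℝ (Fin n) →ₗ[ℝ] EuclideanSpace ℝ (Fin n)))
    (by rw [M.det_act]; exact (Real.exp_pos _).ne')
  rw [M.det_act, ← Real.exp_neg, abs_of_pos (Real.exp_pos _)] at h
  have h2 : (fun x => a + M.act t x) = (a + ·) ∘ (M.act t) := rfl
  rw [h2, ← Measure.map_map (measurable_const_add a) (M.act t).continuous.measurable]
  change Measure.map _ (Measure.map (M.act t : EuclideanSpace ℝ (Fin n) →ₗ[ℝ]
    EuclideanSpace ℝ (Fin n)) volume) = _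
  rw [h, Measure.map_smul, map_add_left_eq_self]

theorem measurable_mul_left (g : SolvGroup M) : Measurable (g * ·) := by
  have h : Measurable fun v : EModel n =>
      ((g.pos + M.act g.height v.1, g.height + v.2) : EModel n) :=
    (measurable_const.add ((M.act g.height).continuous.measurable.comp measurable_fst)).prodMk
      (measurable_const.add measurable_snd)
  exact h

theorem measurable_mul_vertical (s : ℝ) : Measurable (· * mk M 0 s) := by
  have h : Measurable fun v : EModel n => ((v.1 + M.act v.2 0, v.2 + s) : EModel n) := by
    simp only [map_zero, add_zero]
    fun_prop
  exact h

/-- Left translation is the product of an affine map of determinant `det M^t` and a translation of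
the heights, and the two factors by which they scale the product measure cancel. -/
theorem map_mul_left_vol (g : SolvGroup M) : (vol M).map (g * ·) = vol M := by
  have h := Measure.map_prod_map (volume : Measure (EuclideanSpace ℝ (Fin n))) (heightMeasure M)
    (f := fun x => g.pos + M.act g.height x) (g := (g.height + ·)) (by fun_prop) (by fun_prop)
  rw [map_affine_volume, map_add_heightMeasure, Measure.prod_smul_left, Measure.prod_smul_right,
    smul_smul, ← ENNReal.ofReal_mul (Real.exp_pos _).le, ← Real.exp_add, neg_add_cancel,
    Real.exp_zero, ENNReal.ofReal_one, one_smul] at h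
  exact h.symm

/-- Right translation by `(0, s)` is the upward flow. It only moves the heights, so the volume of
preimages is multiplied by `(det M)^s`. -/
theorem map_mul_vertical_vol (s : ℝ) :
    (vol M).map (· * mk M 0 s) = ENNReal.ofReal (Real.exp (s * M.rate)) • vol M := by
  have h := Measure.map_prod_map (volume : Measure (EuclideanSpace ℝ (Fin n))) (heightMeasure M)
    (f := id) (g := (s + ·)) (by fun_prop) (by fun_prop)
  rw [Measure.map_id, map_add_heightMeasure, Measure.prod_smul_right] at h
  have e : (· * mk M 0 s) = (Prod.map id (s + ·) : EModel n → EModel n) := by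
    funext v
    exact SolvGroup.ext (M := M) (by simp [mul_pos_eq]; rfl) (add_comm _ _)
  rw [vol, e]
  exact h.symm

theorem vol_preimage_mul_left (g : SolvGroup M) (A : Set (SolvGroup M)) :
    vol M ((g * ·) ⁻¹' A) = vol M A := by
  let e : SolvGroup M ≃ᵐ SolvGroup M :=
    { Equiv.mulLeft g with
      measurable_toFun := measurable_mul_left g
      measurable_invFun := measurable_mul_left g⁻¹ }
  have h : vol M (e ⁻¹' A) = _ := (e.map_apply (μ := vol M) A).symm
  exact h.trans (congrArg (· A) (map_mul_left_vol g))

theorem vol_smul (g : SolvGroup M) (A : Set (SolvGroup M)) : vol M (g • A) = vol M A := by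
  rw [← Set.preimage_smul_inv]
  exact vol_preimage_mul_left g⁻¹ A

theorem vol_preimage_mul_vertical (s : ℝ) (A : Set (SolvGroup M)) :
    vol M ((· * mk M 0 s) ⁻¹' A) = ENNReal.ofReal (Real.exp (s * M.rate)) * vol M A := by
  have hinv : (mk M 0 s)⁻¹ = mk M 0 (-s) := by
    rw [inv_eq_iff_mul_eq_one]
    exact SolvGroup.ext (by rw [mul_pos_eq]; simp; rfl) (add_neg_cancel s)
  let e : SolvGroup M ≃ᵐ SolvGroup M :=
    { Equiv.mulRight (mk M 0 s) with
      measurable_toFun := measurable_mul_vertical s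
      measurable_invFun := by
        change Measurable (· * (mk M 0 s)⁻¹)
        rw [hinv]
        exact measurable_mul_vertical (-s) }
  have h : vol M (e ⁻¹' A) = _ := (e.map_apply (μ := vol M) A).symm
  refine h.trans ?_
  rw [← smul_eq_mul, ← Measure.smul_apply]
  exact congrArg (· A) (map_mul_vertical_vol s)

theorem vol_setOf (B : Set (EuclideanSpace ℝ (Fin n))) (T : Set ℝ) :
    vol M {g | g.pos ∈ B ∧ g.height ∈ T} = volume B * heightMeasure M T :=
  Measure.prod_prod B T

theorem heightMeasure_ne_top {T : Set ℝ} {a b : ℝ} (hT : T ⊆ Icc a b) :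
    heightMeasure M T ≠ ∞ := by
  refine ne_top_of_le_ne_top ?_ (measure_mono hT)
  have : IntegrableOn (fun t : ℝ => Real.exp (-(t * M.rate))) (Icc a b) :=
    (by fun_prop : Continuous fun t : ℝ => Real.exp (-(t * M.rate))).integrableOn_Icc
  rw [heightMeasure, withDensity_apply _ measurableSet_Icc]
  exact this.lintegral_lt_top.ne

theorem heightMeasure_Icc_ne_zero {a b : ℝ} (h : a < b) : heightMeasure M (Icc a b) ≠ 0 := by
  have hm : Measurable fun t : ℝ => ENNReal.ofReal (Real.exp (-(t * M.rate))) := by fun_prop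
  rw [heightMeasure, Ne, withDensity_apply_eq_zero hm]
  have e : {t : ℝ | ENNReal.ofReal (Real.exp (-(t * M.rate))) ≠ 0} = univ :=
    eq_univ_of_forall fun t => by simp [Real.exp_pos]
  rw [e, univ_inter, Real.volume_Icc, ENNReal.ofReal_eq_zero, not_le]
  exact sub_pos.2 h

theorem heightMeasure_Ici_ne_top (hM : 0 < M.rate) : heightMeasure M (Ici 0) ≠ ∞ := by
  have h : IntegrableOn (fun t : ℝ => Real.exp (-M.rate * t)) (Ici 0) :=
    (integrableOn_Ici_iff_integrableOn_Ioi (by finiteness)).2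
      (integrableOn_exp_mul_Ioi (neg_neg_of_pos hM) 0)
  rw [heightMeasure, withDensity_apply _ measurableSet_Ici]
  convert h.lintegral_lt_top.ne using 5
  ring

/-- Sets of bounded diameter have uniformly bounded volume. -/
theorem exists_vol_le (M : OneParamSubgroup n) (r : ℝ≥0) :
    ∃ V : ℝ≥0∞, V ≠ ∞ ∧ ∀ S : Set (SolvGroup M),
      (∀ p ∈ S, ∀ q ∈ S, edist p q < r) → vol M S ≤ V := by
  obtain ⟨b, -, hb⟩ := exists_coord_bound M r
  let D : Set (SolvGroup M) := {g | g.pos ∈ Metric.closedBall 0 b ∧ g.height ∈ Icc (-(r : ℝ)) r}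
  refine ⟨vol M D, ?_, fun S hS => ?_⟩
  · rw [vol_setOf]
    exact ENNReal.mul_ne_top measure_closedBall_lt_top.ne (heightMeasure_ne_top subset_rfl)
  · obtain rfl | ⟨p, hp⟩ := S.eq_empty_or_nonempty
    · simp
    rw [← vol_smul p D]
    refine measure_mono fun q hq => ?_
    obtain ⟨h1, h2⟩ := hb p q (hS p hp q hq)
    refine ⟨mk M (M.act (-p.height) (q.pos - p.pos)) (q.height - p.height),
      ⟨by simpa using h2, abs_le.1 h1⟩, SolvGroup.ext ?_ ?_⟩
    · change p.pos + M.act p.height (M.act (-p.height) (q.pos - p.pos)) = q.pos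
      rw [← M.act_add, add_neg_cancel, M.act_zero, add_sub_cancel]
    · exact add_sub_cancel _ _

/-! ### Packings by translates of a box -/

/-- The set of `(v, τ)` with `‖v‖ ≤ 1` and `0 ≤ τ ≤ 1`. Its left translates by points of a horoball
stay in the horoball. -/
def box (M : OneParamSubgroup n) : Set (SolvGroup M) :=
  {g | g.pos ∈ Metric.closedBall 0 1 ∧ g.height ∈ Icc 0 1}

theorem measurableSet_box : MeasurableSet (box M) :=
  (measurable_pos Metric.isClosed_closedBall.measurableSet).inter
    (measurable_height measurableSet_Icc)

theorem vol_box_ne_zero : vol M (box M) ≠ 0 := by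
  rw [box, vol_setOf]
  exact mul_ne_zero (Metric.measure_closedBall_pos _ _ one_pos).ne'
    (heightMeasure_Icc_ne_zero one_pos)

theorem vol_box_ne_top : vol M (box M) ≠ ∞ := by
  rw [box, vol_setOf]
  exact ENNReal.mul_ne_top measure_closedBall_lt_top.ne (heightMeasure_ne_top subset_rfl)

/-- A maximal family of disjoint translates of the box with base points in `A`. -/
theorem exists_packing {A : Set (SolvGroup M)} (hA : vol M (A * box M) ≠ ∞) :
    ∃ P : Finset (SolvGroup M), ↑P ⊆ A ∧ P.card * vol M (box M) ≤ vol M (A * box M) ∧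
      ∀ a ∈ A, ∃ p ∈ P, ((a • box M) ∩ (p • box M)).Nonempty := by
  classical
  let good : Finset (SolvGroup M) → Prop := fun P => ↑P ⊆ A ∧
    (P : Set (SolvGroup M)).PairwiseDisjoint fun p => p • box M
  have hmeas : ∀ p : SolvGroup M, MeasurableSet (p • box M) := fun p => by
    rw [← Set.preimage_smul_inv]
    exact measurable_mul_left p⁻¹ measurableSet_box
  have hcard : ∀ P, good P → P.card * vol M (box M) ≤ vol M (A * box M) := by
    intro P hP
    calc P.card * vol M (box M) = ∑ p ∈ P, vol M (p • box M) := by simp [vol_smul]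
      _ = vol M (⋃ p ∈ P, p • box M) :=
        (measure_biUnion_finset hP.2 fun p _ => hmeas p).symm
      _ ≤ _ := measure_mono (iUnion₂_subset fun p hp => by
        rintro _ ⟨u, hu, rfl⟩
        exact mul_mem_mul (hP.1 hp) hu)
  obtain ⟨m, hm⟩ := ENNReal.exists_nat_gt (ENNReal.div_ne_top hA (vol_box_ne_zero (M := M)))
  have hbound : ∀ P, good P → P.card ≤ m := by
    intro P hP
    have h := (ENNReal.le_div_iff_mul_le (Or.inl vol_box_ne_zero) (Or.inl vol_box_ne_top)).2
      (hcard P hP)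
    exact_mod_cast (h.trans hm.le)
  let k := Nat.findGreatest (fun k => ∃ P, good P ∧ P.card = k) m
  obtain ⟨P, hP, hPk⟩ : ∃ P, good P ∧ P.card = k :=
    Nat.findGreatest_spec (P := fun k => ∃ P, good P ∧ P.card = k) (Nat.zero_le m)
      ⟨∅, by simp [good], rfl⟩
  refine ⟨P, hP.1, hcard P hP, fun a ha => ?_⟩
  by_contra! hcon
  have haP : a ∉ P := fun h => by
    have := hcon a h
    rw [inter_self] at this
    have h2 := vol_smul a (box M)
    rw [this, measure_empty] at h2
    exact vol_box_ne_zero h2.symm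
  have hgood : good (insert a P) := by
    refine ⟨by simpa [insert_subset_iff] using ⟨ha, hP.1⟩, ?_⟩
    rw [Finset.coe_insert]
    exact hP.2.insert fun p hp _ => disjoint_iff_inter_eq_empty.2 (hcon p hp)
  have h := Nat.le_findGreatest (P := fun k => ∃ P, good P ∧ P.card = k) (hbound _ hgood)
    ⟨_, hgood, rfl⟩
  rw [Finset.card_insert_of_notMem haP, hPk] at h
  exact absurd h (by simp [k])

end SolvGroup

/-! ### The path metric of the doubled horoball -/

namespace DoubledHoroball

open Pointwise

variable {n : ℕ} {M : OneParamSubgroup n}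

/-- The folding map `H_M → G_M`. -/
def fold (p : DoubledHoroball M) : SolvGroup M := p.toGlued.fold

/-- The point `g` of the copy of the horoball with index `b`. -/
def mk (b : Bool) (g : Horoball M) : DoubledHoroball M := GluedHoroballs.mk b g

theorem fold_mk (b : Bool) (g : Horoball M) : (mk b g).fold = g := rfl

theorem exists_mk (p : DoubledHoroball M) : ∃ b g, p = mk b g := by
  obtain ⟨⟨b, g⟩, rfl⟩ := Quotient.exists_rep (s := gluingSetoid M) p
  exact ⟨b, g, rfl⟩

/-- The folding map is `1`-Lipschitz, since lengths in `H_M` are measured after folding. -/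
theorem edist_fold_le (p q : DoubledHoroball M) : edist p.fold q.fold ≤ edist p q := by
  refine le_iInf fun γ => ?_
  have h := eVariationOn.edist_le (fun s => (γ s).fold) (mem_univ (0 : unitInterval))
    (mem_univ (1 : unitInterval))
  rw [γ.source, γ.target] at h
  exact h

theorem continuous_gluedMk (b : Bool) : Continuous (GluedHoroballs.mk (M := M) b) :=
  (continuous_quotient_mk' (s := gluingSetoid M)).comp (continuous_const.prodMk continuous_id)

/-- A Lipschitz curve inside one copy of the horoball bounds the path metric. -/
theorem edist_mk_le_of_lipschitz (b : Bool) {c : ℝ≥0} {η : unitInterval → Horoball M}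
    (h : LipschitzWith c fun s => (η s : SolvGroup M)) {p q : Horoball M} (h0 : η 0 = p)
    (h1 : η 1 = q) : edist (mk b p) (mk b q) ≤ c := by
  have hη : Continuous η := h.continuous.subtype_mk _
  let γ : Path (GluedHoroballs.mk b p) (GluedHoroballs.mk b q) :=
    { toFun := fun s => GluedHoroballs.mk b (η s)
      continuous_toFun := (continuous_gluedMk b).comp hη
      source' := by rw [h0]
      target' := by rw [h1] }
  refine (iInf_le _ γ).trans ?_
  have h2 : GluedHoroballs.length γ ≤ c * eVariationOn (id : unitInterval → unitInterval) univ :=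
    (h.lipschitzOnWith (s := univ)).comp_eVariationOn_le (mapsTo_univ id univ)
  have h3 : eVariationOn (id : unitInterval → unitInterval) univ ≤ 1 := by
    have h4 := ((Subtype.mono_coe (· ∈ unitInterval)).monotoneOn univ).eVariationOn_eq
      (mem_univ (0 : unitInterval)) (mem_univ (1 : unitInterval))
    have h5 : (univ : Set unitInterval) ∩ Icc 0 1 = univ := by
      rw [univ_inter]
      exact Icc_bot_top
    rw [h5] at h4
    exact h4.le.trans (by simp)
  calc _ ≤ c * eVariationOn (id : unitInterval → unitInterval) univ := h2
    _ ≤ c * 1 := by gcongr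
    _ = c := mul_one _

theorem edist_mk_horizontal_le (b : Bool) (x w : EuclideanSpace ℝ (Fin n)) {t : ℝ} (ht : 0 ≤ t) :
    edist (mk b ⟨SolvGroup.mk M x t, ht⟩) (mk b ⟨SolvGroup.mk M (x + w) t, ht⟩) ≤
      ENNReal.ofReal ‖M.act (-t) w‖ := by
  let η : unitInterval → Horoball M := fun s => ⟨SolvGroup.mk M (x + (s : ℝ) • w) t, ht⟩
  refine edist_mk_le_of_lipschitz b (c := Real.toNNReal ‖M.act (-t) w‖) (η := η) ?_ ?_ ?_
  · intro s s'
    have h := SolvGroup.edist_horizontal_le (M := M) (x + (s : ℝ) • w) (((s' : ℝ) - s) • w) t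
    rw [add_assoc, ← add_smul, add_sub_cancel] at h
    refine h.trans ?_
    rw [map_smul, norm_smul, mul_comm, ENNReal.ofReal_mul (norm_nonneg _), edist_comm,
      Subtype.edist_eq, edist_dist, Real.dist_eq, Real.norm_eq_abs]
    rfl
  · simp [η]
  · simp [η]

theorem edist_mk_vertical_le (b : Bool) (x : EuclideanSpace ℝ (Fin n)) {t τ : ℝ} (ht : 0 ≤ t)
    (hτ : 0 ≤ τ) :
    edist (mk b ⟨SolvGroup.mk M x t, ht⟩)
      (mk b ⟨SolvGroup.mk M x (t + τ), add_nonneg ht hτ⟩) ≤ ENNReal.ofReal τ := by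
  let η : unitInterval → Horoball M := fun s =>
    ⟨SolvGroup.mk M x (t + s * τ), add_nonneg ht (mul_nonneg s.2.1 hτ)⟩
  refine edist_mk_le_of_lipschitz b (c := Real.toNNReal τ) (η := η) ?_ ?_ ?_
  · intro s s'
    have h := SolvGroup.edist_vertical_le (M := M) x (t + s * τ) (((s' : ℝ) - s) * τ)
    rw [add_assoc, ← add_mul, add_sub_cancel] at h
    refine h.trans ?_
    rw [abs_mul, abs_of_nonneg hτ, mul_comm, ENNReal.ofReal_mul hτ, edist_comm,
      Subtype.edist_eq, edist_dist, Real.dist_eq]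
    rfl
  · simp [η]
  · simp [η]

/-- Translating by an element of the box moves upwards, so the points remain in their copy of the
horoball and are joined there by a horizontal and a vertical segment of length at most `1`. -/
theorem edist_mk_mul_box_le (b : Bool) (p : Horoball M) {u : SolvGroup M}
    (hu : u ∈ SolvGroup.box M) :
    edist (mk b p) (mk b ⟨p * u, add_nonneg p.2 hu.2.1⟩) ≤ 2 := by
  have h1 := edist_mk_horizontal_le (M := M) b p.1.pos (M.act p.1.height u.pos) p.2
  have h2 := edist_mk_vertical_le (M := M) b (p.1.pos + M.act p.1.height u.pos) p.2 hu.2.1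
  rw [← M.act_add, neg_add_cancel, M.act_zero] at h1
  have hu1 : ‖u.pos‖ ≤ 1 := by simpa using hu.1
  calc _ ≤ _ := (edist_triangle _ _ _).trans (add_le_add h1 h2)
    _ ≤ 1 + 1 := add_le_add (ENNReal.ofReal_le_one.2 hu1) (ENNReal.ofReal_le_one.2 hu.2.2)
    _ = 2 := one_add_one_eq_two

theorem edist_mk_le_of_inter_nonempty (b : Bool) (p q : Horoball M)
    (h : (((p : SolvGroup M) • SolvGroup.box M) ∩
      ((q : SolvGroup M) • SolvGroup.box M)).Nonempty) :
    edist (mk b p) (mk b q) ≤ 4 := by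
  obtain ⟨_, ⟨u, hu, rfl⟩, ⟨v, hv, huv⟩⟩ := h
  have h1 := edist_mk_mul_box_le b p hu
  have h2 := edist_mk_mul_box_le b q hv
  have e : (⟨q * v, add_nonneg q.2 hv.2.1⟩ : Horoball M) = ⟨p * u, add_nonneg p.2 hu.2.1⟩ :=
    Subtype.ext huv
  rw [e, edist_comm] at h2
  calc _ ≤ _ := (edist_triangle _ _ _).trans (add_le_add h1 h2)
    _ = 4 := by norm_num

end DoubledHoroball

/-! ### Distances and the box in the solvable group -/

namespace SolvGroup

open Pointwise

variable {n : ℕ} {M : OneParamSubgroup n}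

theorem edist_mul_box_le (p : SolvGroup M) {u : SolvGroup M} (hu : u ∈ box M) :
    edist p (p * u) ≤ 2 := by
  have h1 := edist_horizontal_le (M := M) p.pos (M.act p.height u.pos) p.height
  have h2 := edist_vertical_le (M := M) (p.pos + M.act p.height u.pos) p.height u.height
  rw [← M.act_add, neg_add_cancel, M.act_zero] at h1
  have hu1 : ‖u.pos‖ ≤ 1 := by simpa using hu.1
  have hu2 : |u.height| ≤ 1 := by rw [abs_of_nonneg hu.2.1]; exact hu.2.2
  calc _ ≤ _ := (edist_triangle _ _ _).trans (add_le_add h1 h2)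
    _ ≤ 1 + 1 := add_le_add (ENNReal.ofReal_le_one.2 hu1) (ENNReal.ofReal_le_one.2 hu2)
    _ = 2 := one_add_one_eq_two

theorem edist_le_of_inter_nonempty {p q : SolvGroup M}
    (h : ((p • box M) ∩ (q • box M)).Nonempty) : edist p q ≤ 4 := by
  obtain ⟨_, ⟨u, hu, rfl⟩, ⟨v, hv, huv⟩⟩ := h
  have h1 := edist_mul_box_le p hu
  have h2 := edist_mul_box_le q hv
  have e : q * v = p * u := huv
  rw [e, edist_comm] at h2
  calc _ ≤ _ := (edist_triangle _ _ _).trans (add_le_add h1 h2)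
    _ = 4 := by norm_num

theorem edist_mul_vertical_le (p : SolvGroup M) (s : ℝ) :
    edist p (p * mk M 0 s) ≤ ENNReal.ofReal |s| := by
  have e : p * mk M 0 s = mk M p.pos (p.height + s) :=
    SolvGroup.ext (by simp [mul_pos_eq]) rfl
  rw [e]
  exact edist_vertical_le (M := M) p.pos p.height s

/-! ### Neighbourhoods of slabs in the horoball -/

/-- The part of height at most `1` of the horoball over the ball of radius `L`. -/
def slab (M : OneParamSubgroup n) (L : ℝ) : Set (SolvGroup M) :=
  {g | g.pos ∈ Metric.closedBall 0 L ∧ g.height ∈ Icc 0 1}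

open MeasureTheory in
/-- For large `L` the part of the horoball within `r` of the slab over the ball of radius `L` lies
over the ball of radius `2 L`, so its volume is bounded by a multiple of the volume of the ball of
radius `L` that does not depend on `r`. This is the amenability of the doubled horoball. -/
theorem exists_vol_nhd_slab_le (M : OneParamSubgroup n) (r : ℝ≥0) :
    ∃ L : ℝ, 0 < L ∧ ∀ S : Set (SolvGroup M),
      (∀ g ∈ S, 0 ≤ g.height ∧ ∃ f ∈ slab M L, edist f g < r) →
      vol M (S * box M) ≤ 2 ^ n * volume (Metric.closedBall (0 : EuclideanSpace ℝ (Fin n)) L) *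
        heightMeasure M (Ici 0) := by
  obtain ⟨b, hb0, hb⟩ := exists_coord_bound M r
  obtain ⟨K, hK⟩ : ∃ K, ∀ τ ∈ Icc (0 : ℝ) (1 + r), ‖M.act τ‖ ≤ K :=
    isCompact_Icc.exists_bound_of_continuousOn M.continuous_act.continuousOn
  have hK0 : 0 ≤ K := (norm_nonneg _).trans (hK 0 ⟨le_rfl, by positivity⟩)
  refine ⟨K * b + K + 1, by positivity, fun S hS => ?_⟩
  set L := K * b + K + 1 with hL
  have hball : volume (Metric.closedBall (0 : EuclideanSpace ℝ (Fin n)) (2 * L)) =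
      2 ^ n * volume (Metric.closedBall (0 : EuclideanSpace ℝ (Fin n)) L) := by
    rw [Measure.addHaar_closedBall_mul _ _ zero_le_two (by positivity)]
    simp
  rw [← hball, ← vol_setOf]
  refine measure_mono ?_
  rintro _ ⟨g, hg, u, hu, rfl⟩
  obtain ⟨hg0, f, hf, hfg⟩ := hS g hg
  obtain ⟨h1, h2⟩ := hb f g hfg
  have hf1 : ‖f.pos‖ ≤ L := by simpa using hf.1
  have hu1 : ‖u.pos‖ ≤ 1 := by simpa using hu.1
  have e : g.pos - f.pos = M.act f.height (M.act (-f.height) (g.pos - f.pos)) := by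
    rw [← M.act_add, add_neg_cancel, M.act_zero]
  have hKf := hK f.height ⟨hf.2.1, hf.2.2.trans (by simp)⟩
  have hKg := hK g.height ⟨hg0, by linarith [(abs_le.1 h1).2, hf.2.2]⟩
  have h3 : ‖g.pos - f.pos‖ ≤ K * b := by
    rw [e]
    exact ((M.act _).le_opNorm _).trans (mul_le_mul hKf h2 (norm_nonneg _) hK0)
  have h4 : ‖M.act g.height u.pos‖ ≤ K * 1 :=
    ((M.act _).le_opNorm _).trans (mul_le_mul hKg hu1 (norm_nonneg _) hK0)
  refine ⟨?_, add_nonneg hg0 hu.2.1⟩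
  rw [mem_closedBall_zero_iff]
  change ‖g.pos + M.act g.height u.pos‖ ≤ 2 * L
  have h5 : g.pos + M.act g.height u.pos = f.pos + (g.pos - f.pos) + M.act g.height u.pos := by
    abel
  rw [h5]
  refine (norm_add₃_le).trans ?_
  linarith

end SolvGroup

/-! ### Comparison of volumes along a quasi-isometry -/

open Pointwise MeasureTheory in
/-- A quasi-isometry would transport the exponential growth of volume under upward flow in `G_M` to
the slabs of `H_N`, whose neighbourhoods have volume bounded by a fixed multiple of their own. -/
theorem not_isQuasiIsometry {n : ℕ} {M N : OneParamSubgroup n} (hM : 0 < M.rate) (hN : 0 < N.rate)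
    (φ : SolvGroup M → DoubledHoroball N) : ¬ IsQuasiIsometry φ := by
  classical
  rintro ⟨K, C, -, hqi, hdense⟩
  have hpre : ∀ g g', edist (φ g) (φ g') ≤ 8 → edist g g' < ((8 + C) * K + 1 : ℝ≥0) := by
    intro g g' h
    have h1 := tsub_le_iff_right.1 ((hqi g g').1.trans h)
    have h2 := (ENNReal.div_le_iff_le_mul (Or.inr (by finiteness))
      (Or.inl ENNReal.coe_ne_top)).1 h1
    refine h2.trans_lt ?_
    exact_mod_cast lt_add_one ((8 + C) * K)
  have hsurj : ∀ y, ∃ g, edist y (φ g) ≤ C + 1 := by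
    intro y
    obtain ⟨_, ⟨g, rfl⟩, hg⟩ := Metric.infEDist_lt_iff.1
      ((hdense y).trans_lt (ENNReal.lt_add_right ENNReal.coe_ne_top one_ne_zero))
    exact ⟨g, hg.le⟩
  obtain ⟨V, hV, hVle⟩ := SolvGroup.exists_vol_le M ((8 + C) * K + 1)
  let r : ℝ≥0 := C + 1 + (K * 4 + C)
  obtain ⟨V', hV', hVle'⟩ := SolvGroup.exists_vol_le N (r + r + 1)
  set uM := SolvGroup.vol M (SolvGroup.box M) with huM
  set uN := SolvGroup.vol N (SolvGroup.box N) with huN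
  set ν₁ := SolvGroup.heightMeasure N (Icc 0 1) with hν₁
  set ν := SolvGroup.heightMeasure N (Ici 0) with hν
  -- The time `s` of the flow is chosen before the slab: all other constants are independent of it.
  obtain ⟨s, hs0, hs⟩ : ∃ s : ℝ, 0 ≤ s ∧
      2 * V * V' * 2 ^ n * ν < ENNReal.ofReal (Real.exp (s * M.rate)) * (ν₁ * uM * uN) := by
    have ha : ν₁ * uM * uN ≠ 0 := mul_ne_zero (mul_ne_zero
      (SolvGroup.heightMeasure_Icc_ne_zero one_pos) SolvGroup.vol_box_ne_zero)
      SolvGroup.vol_box_ne_zero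
    have hb : 2 * V * V' * 2 ^ n * ν ≠ ∞ := by
      have := SolvGroup.heightMeasure_Ici_ne_top hN
      finiteness
    obtain ⟨m, hm⟩ := ENNReal.exists_nat_gt (ENNReal.div_ne_top hb ha)
    have hm' := (ENNReal.div_lt_iff (Or.inl ha) (Or.inr hb)).1 hm
    refine ⟨m / M.rate, by positivity, hm'.trans_le ?_⟩
    gcongr
    rw [div_mul_cancel₀ _ hM.ne', ← ENNReal.ofReal_natCast]
    exact ENNReal.ofReal_le_ofReal ((le_add_of_nonneg_right zero_le_one).trans
      (Real.add_one_le_exp _))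
  let σ : ℝ≥0 := ⟨s, hs0⟩
  let R : ℝ≥0 := C + 1 + (K * (σ + 2) + C)
  obtain ⟨L, hL0, hL⟩ := SolvGroup.exists_vol_nhd_slab_le N (R + 1)
  set B := volume (Metric.closedBall (0 : EuclideanSpace ℝ (Fin n)) L) with hB
  have hB0 : B ≠ 0 := (Metric.measure_closedBall_pos _ _ hL0).ne'
  have hBtop : B ≠ ∞ := measure_closedBall_lt_top.ne
  -- `S` contains the folded image of the `R`-neighbourhood of the doubled slab.
  let S : Set (SolvGroup N) :=
    {g | 0 ≤ g.height ∧ ∃ f ∈ SolvGroup.slab N L, edist f g < (R + 1 : ℝ≥0)}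
  have hS := hL S fun g hg => hg
  obtain ⟨P', hP'S, hP'card, hP'⟩ := SolvGroup.exists_packing (A := S) (ne_top_of_le_ne_top (by
    have := SolvGroup.heightMeasure_Ici_ne_top hN
    finiteness) hS)
  -- The coarse preimage of the doubled slab; `X` is the volume of a thickening of it.
  let A : Set (SolvGroup M) :=
    {g | ∃ f : DoubledHoroball N, f.fold ∈ SolvGroup.slab N L ∧ edist f (φ g) ≤ C + 1}
  set X := SolvGroup.vol M (A * SolvGroup.box M) with hX
  -- The image of the thickening of `A` under the downward flow for time `s` is covered by the
  -- preimages of the balls around the points of the packing of `S`, in both copies.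
  have h1 : ENNReal.ofReal (Real.exp (s * M.rate)) * X ≤ 2 * P'.card * V := by
    rw [hX, ← SolvGroup.vol_preimage_mul_vertical]
    let T : Bool → SolvGroup N → Set (SolvGroup M) := fun b p =>
      {w | ∃ h : 0 ≤ p.height, edist (φ w) (DoubledHoroball.mk b ⟨p, h⟩) ≤ 4}
    have hT : ∀ b p, SolvGroup.vol M (T b p) ≤ V := fun b p => hVle _ fun w hw w' hw' => by
      obtain ⟨h, hw⟩ := hw
      obtain ⟨h', hw'⟩ := hw'
      refine hpre w w' ((edist_triangle_right _ _ _).trans ((add_le_add hw hw').trans_eq ?_))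
      norm_num
    calc _ ≤ SolvGroup.vol M (⋃ b ∈ (Finset.univ : Finset Bool), ⋃ p ∈ P', T b p) := by
          refine measure_mono fun w hw => ?_
          obtain ⟨a, ⟨f, hf, hfa⟩, u, hu, hau⟩ := hw
          have hau' : a * u = w * SolvGroup.mk M 0 s := hau
          have hwa : edist a w ≤ σ + 2 := by
            have e1 := SolvGroup.edist_mul_vertical_le w s
            have e2 := SolvGroup.edist_mul_box_le a hu
            rw [hau'] at e2
            rw [abs_of_nonneg hs0, ENNReal.ofReal_eq_coe_nnreal hs0] at e1
            rw [add_comm]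
            exact (edist_triangle_right _ _ _).trans (add_le_add e2 e1)
          have hfw : edist f (φ w) ≤ R := by
            have e := (hqi a w).2.trans (add_le_add (mul_le_mul_right hwa _) le_rfl)
            exact ((edist_triangle _ _ _).trans (add_le_add hfa e)).trans_eq (by simp [R])
          obtain ⟨b, g, hg⟩ := (φ w).exists_mk
          have hgS : (g : SolvGroup N) ∈ S := by
            refine ⟨g.2, f.fold, hf, ?_⟩
            rw [← DoubledHoroball.fold_mk b g, ← hg]
            refine ((DoubledHoroball.edist_fold_le _ _).trans hfw).trans_lt ?_
            exact_mod_cast lt_add_one R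
          obtain ⟨p, hp, hgp⟩ := hP' _ hgS
          simp only [mem_iUnion]
          refine ⟨b, Finset.mem_univ b, p, hp, (hP'S hp).1, ?_⟩
          rw [hg]
          exact DoubledHoroball.edist_mk_le_of_inter_nonempty b g ⟨p, (hP'S hp).1⟩ hgp
      _ ≤ ∑ _b : Bool, ∑ _p ∈ P', V :=
          (measure_biUnion_finset_le _ _).trans (Finset.sum_le_sum fun b _ =>
            (measure_biUnion_finset_le _ _).trans (Finset.sum_le_sum fun p _ => hT b p))
      _ = 2 * P'.card * V := by simp [mul_assoc]
  have hXtop : X ≠ ∞ := fun h => by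
    rw [h, ENNReal.mul_top (by simp [Real.exp_pos])] at h1
    exact absurd h1 (not_le.2 (by finiteness))
  obtain ⟨P, hPA, hPcard, hP⟩ := SolvGroup.exists_packing hXtop
  -- Conversely, the slab is covered by the folded balls around the images of the packing of `A`.
  have h2 : B * ν₁ ≤ P.card * V' := by
    let T : SolvGroup M → Set (SolvGroup N) := fun p =>
      {g | ∃ y : DoubledHoroball N, y.fold = g ∧ edist y (φ p) ≤ r}
    have hT : ∀ p, SolvGroup.vol N (T p) ≤ V' := fun p => hVle' _ fun g hg g' hg' => by
      obtain ⟨y, rfl, hy⟩ := hg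
      obtain ⟨y', rfl, hy'⟩ := hg'
      refine ((DoubledHoroball.edist_fold_le _ _).trans
        ((edist_triangle_right _ _ _).trans (add_le_add hy hy'))).trans_lt ?_
      exact_mod_cast lt_add_one (r + r)
    calc B * ν₁ = SolvGroup.vol N (SolvGroup.slab N L) := (SolvGroup.vol_setOf _ _).symm
      _ ≤ SolvGroup.vol N (⋃ p ∈ P, T p) := by
          refine measure_mono fun g hg => ?_
          let y : DoubledHoroball N := DoubledHoroball.mk true ⟨g, hg.2.1⟩
          obtain ⟨a, ha⟩ := hsurj y
          obtain ⟨p, hp, hap⟩ := hP a ⟨y, hg, ha⟩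
          refine mem_biUnion hp ⟨y, rfl, ?_⟩
          have e := (hqi a p).2.trans
            (add_le_add (mul_le_mul_right (SolvGroup.edist_le_of_inter_nonempty hap) _) le_rfl)
          exact ((edist_triangle _ _ _).trans (add_le_add ha e)).trans_eq (by simp [r])
      _ ≤ ∑ _p ∈ P, V' :=
          (measure_biUnion_finset_le _ _).trans (Finset.sum_le_sum fun p _ => hT p)
      _ = P.card * V' := by simp
  refine (ENNReal.mul_lt_mul_left hB0 hBtop hs).not_ge ?_
  set E := ENNReal.ofReal (Real.exp (s * M.rate))
  calc E * (ν₁ * uM * uN) * B = E * (B * ν₁) * uM * uN := by ring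
    _ ≤ E * (P.card * V') * uM * uN := by gcongr
    _ = E * (P.card * uM) * V' * uN := by ring
    _ ≤ E * X * V' * uN := by gcongr
    _ ≤ 2 * P'.card * V * V' * uN := by gcongr
    _ = 2 * V * V' * (P'.card * uN) := by ring
    _ ≤ 2 * V * V' * (2 ^ n * B * ν) := mul_le_mul_right (hP'card.trans hS) _
    _ = 2 * V * V' * 2 ^ n * ν * B := by ring

theorem mainTheorem10 {n : ℕ} (M N : OneParamSubgroup n)
    (hM : 1 < (M.mat 1).det) (hN : 1 < (N.mat 1).det) :
    ¬ ∃ φ : SolvGroup M → DoubledHoroball N,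
      IsQuasiIsometry φ ∧
        CoarselyRespects φ (SolvGroup.horizontalFoliation M)
          (DoubledHoroball.horizontalFoliation N) := by
  rintro ⟨φ, hφ, -⟩
  exact not_isQuasiIsometry (Real.log_pos hM) (Real.log_pos hN) φ hφ
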